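/- A triangulation of the torus is a finite (abstract) simplicial complex $K$ of dimension at most $2$ in which the link of every vertex is a cycle and whose geometric realization $|K|$ is homeomorphic to $S^1\times S^1$. It is even if every vertex has even degree (number of incident edges), and vertex-colorable if its vertices can be colored with three colors so that adjacent vertices have different colors. Let $C\subset|K|$ be a simple closed curve, that is, the image of a continuous injective map $S^1\to|K|$; it may cross triangles and need not run along edges. Cutting along $C$ divides every closed triangle $\tau$ of $K$ into pieces, the connected components of $\tau\setminus C$; a piece of $\tau$ and a piece of a triangle $\sigma$ are still glued to each other if they have a point in common. We say that $K$ becomes vertex-colorable after cutting along $C$ if one can choose, for every piece of every triangle $\tau$, a bijective coloring of the three vertices of $\tau$ by three colors, in such a way that pieces of $\tau$ and $\sigma$ that are glued to each other give the same color to every common vertex of $\tau$ and $\sigma$. (If $C$ runs along edges of $K$, this means that the triangulated surface obtained by cutting along $C$ is vertex-colorable.) Theorem. Every even triangulation $K$ of the torus is vertex-colorable, or there is a simple closed curve $C\subset|K|$ such that $K$ becomes vertex-colorable after cutting along $C$. -/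

import Mathlib

open scoped Finset

namespace AbstractSimplicialComplex

variable {V : Type*}

/-- The graph (1-skeleton) of a simplicial complex: distinct vertices are adjacent when they span an
edge. -/
def graph [DecidableEq V] (K : AbstractSimplicialComplex V) : SimpleGraph V where
  Adj u v := u ≠ v ∧ {u, v} ∈ K.faces
  symm := ⟨fun u v h => ⟨h.1.symm, by rw [Finset.pair_comm]; exact h.2⟩⟩
  loopless := ⟨fun _ h => h.1 rfl⟩

/-- The degree of a vertex: the number of edges containing it, that is, of its neighbours. -/
noncomputable def vertexDegree [DecidableEq V] (K : AbstractSimplicialComplex V) (v : V) : ℕ :=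
  (K.graph.neighborSet v).ncard

/-- A complex is even when all its vertices have even degree. -/
def IsEven [DecidableEq V] (K : AbstractSimplicialComplex V) : Prop :=
  ∀ v, Even (K.vertexDegree v)

/-- A complex is vertex-colorable when its vertices can be colored in three colors so that
neighbours have different colors. -/
def VertexColorable [DecidableEq V] (K : AbstractSimplicialComplex V) : Prop :=
  K.graph.Colorable 3

/-- The link of a vertex `v` of a 2-dimensional complex, as a graph on the neighbours of `v`: two of
them are joined when they span a triangle together with `v`. -/
def linkGraph [DecidableEq V] (K : AbstractSimplicialComplex V) (v : V) :
    SimpleGraph (K.graph.neighborSet v) where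
  Adj a b := a ≠ b ∧ {v, (a : V), (b : V)} ∈ K.faces
  symm := ⟨fun a b h => ⟨h.1.symm, by rw [Finset.pair_comm (b : V) (a : V)]; exact h.2⟩⟩
  loopless := ⟨fun _ h => h.1 rfl⟩

/-- A triangulated closed surface: a complex of dimension at most two in which the link of
every vertex is a cycle (a connected graph, regular of degree two). -/
structure IsTriangulatedClosedSurface [DecidableEq V] (K : AbstractSimplicialComplex V) : Prop where
  card_le_three : ∀ s ∈ K.faces, #s ≤ 3
  link_connected : ∀ v, (K.linkGraph v).Connected
  link_regular : ∀ v a, ((K.linkGraph v).neighborSet a).ncard = 2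

/-- The closed simplex spanned by the vertices in `s`, in barycentric coordinates. -/
def closedCell [Fintype V] (s : Finset V) : Set (V → ℝ) :=
  {x | x ∈ stdSimplex ℝ V ∧ ∀ v, v ∉ s → x v = 0}

/-- The geometric realization of a finite complex, a subspace of `V → ℝ`. -/
def realization [Fintype V] (K : AbstractSimplicialComplex V) : Set (V → ℝ) :=
  {x | ∃ s ∈ K.faces, x ∈ closedCell s}

/-- A triangulation of the torus: a triangulated closed surface whose realization is homeomorphic to
the product of two circles. -/
structure IsTorusTriangulation [Fintype V] [DecidableEq V] (K : AbstractSimplicialComplex V) :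
    Prop where
  surface : K.IsTriangulatedClosedSurface
  homeo_torus : Nonempty (K.realization ≃ₜ UnitAddCircle × UnitAddCircle)

/-- The triangulated surface becomes vertex-colorable after cutting along `C`.
Cutting along `C` divides a closed triangle `τ` into pieces, the connected components of the
complement of `C` in it; pieces of two triangles are still glued to each other at their common
points outside `C`. The color which the piece of `τ` through the point `x` gives to the vertex `v`
of `τ` is `φ τ x v`: every piece colors the three vertices of its triangle in three different
colors, and two pieces that are glued at a point give the same color to every vertex that their
triangles share. -/
def ColorableAfterCutting [Fintype V] (K : AbstractSimplicialComplex V) (C : Set (V → ℝ)) : Prop :=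
  ∃ φ : Finset V → (V → ℝ) → V → Fin 3,
    (∀ τ ∈ K.faces, #τ = 3 → ∀ x ∈ closedCell τ \ C, Set.InjOn (φ τ x) τ) ∧
    (∀ τ ∈ K.faces, #τ = 3 → ∀ S ⊆ closedCell τ \ C, IsPreconnected S →
      ∀ x ∈ S, ∀ y ∈ S, ∀ v ∈ τ, φ τ x v = φ τ y v) ∧
    (∀ τ ∈ K.faces, #τ = 3 → ∀ σ ∈ K.faces, #σ = 3 →
      ∀ x ∈ (closedCell τ ∩ closedCell σ) \ C, ∀ v ∈ τ, v ∈ σ → φ τ x v = φ σ x v)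

end AbstractSimplicialComplex

/-!
The link of a vertex `v` is an even cycle, hence the closed star of `v` has a proper 3-coloring
`c v`. For adjacent `v` and `w` the colorings `c v` and `c w` differ by one permutation of the three
colors, because the two triangles on the edge `vw` force the same one. These permutations form a
Čech cocycle on the cover of the torus by the open stars. Pulled back to the plane, which is simply
connected, the cocycle becomes trivial, and a trivialization changes under the deck transformations
by a monodromy homomorphism from `ℤ × ℤ` to the symmetric group on three letters.

Commuting permutations of three letters generate a cyclic group of order at most three, so the
monodromy kills a primitive vector `(a, b)`. In the coordinates of the torus in which `(a, b)` is
the first basis vector, the trivialization restricted to the strip `ℝ × (0, 1)` is invariant under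
the deck transformations that preserve the strip, so it descends to the complement of the circle
`S¹ × {0}`. This circle is the curve: off it, the trivialization corrects the colorings `c v`
to colorings that agree wherever the open stars overlap.
-/

open Set Topology AbstractSimplicialComplex

section CechCocycle

variable {ι X G : Type*} [Group G] {U : ι → Set X} {g : ι → ι → G}

/-- The constants `g i j` form a Čech 1-cocycle on the family of sets `U`. The transition functions
of a local system trivialized on every `U i` are only locally constant on `U i ∩ U j`; here they are
constant on the whole of it. -/
def IsCechCocycle (U : ι → Set X) (g : ι → ι → G) : Prop :=
  ∀ i j l x, x ∈ U i → x ∈ U j → x ∈ U l → g i j * g j l = g i l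

/-- The functions `k i`, locally constant on `U i`, trivialize the cocycle `g`: they exhibit
it as a coboundary. The values of `k i` outside `U i` are irrelevant. -/
structure IsCechTrivialization [TopologicalSpace X] (U : ι → Set X) (g : ι → ι → G)
    (k : ι → X → G) : Prop where
  eventually_eq : ∀ i, ∀ x ∈ U i, ∀ᶠ y in 𝓝 x, k i y = k i x
  eq_mul : ∀ i j, ∀ x ∈ U i, x ∈ U j → k j x = k i x * g i j

theorem IsCechCocycle.self_eq_one (hg : IsCechCocycle U g) {i : ι} {x : X} (hx : x ∈ U i) :
    g i i = 1 :=
  mul_eq_right.mp (hg i i i x hx hx hx)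

theorem IsCechCocycle.preimage {Y : Type*} (hg : IsCechCocycle U g) (f : Y → X) :
    IsCechCocycle (fun i => f ⁻¹' U i) g :=
  fun i j l y => hg i j l (f y)

variable [TopologicalSpace X]

/-- The fiber bundle with discrete fiber `G` glued from the products `U i × G` by right
multiplication with the cocycle `g`. Its sections are the trivializations of `g`. -/
noncomputable def cechFiberBundleCore [TopologicalSpace G] [DiscreteTopology G]
    (hU : ∀ i, IsOpen (U i)) (cover : ∀ x, ∃ i, x ∈ U i) (hg : IsCechCocycle U g) :
    FiberBundleCore ι X G where
  baseSet := U
  isOpen_baseSet := hU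
  indexAt x := (cover x).choose
  mem_baseSet_at x := (cover x).choose_spec
  coordChange i j _ a := a * g i j
  coordChange_self i x hx a := by rw [hg.self_eq_one hx, mul_one]
  continuousOn_coordChange i j :=
    ((continuous_of_discreteTopology (f := (· * g i j))).comp continuous_snd).continuousOn
  coordChange_comp i j l x hx a := by rw [mul_assoc, hg i j l x hx.1.1 hx.1.2 hx.2]

theorem IsCechCocycle.exists_isCechTrivialization [SimplyConnectedSpace X]
    [LocallyPathConnectedSpace X] (hU : ∀ i, IsOpen (U i)) (cover : ∀ x, ∃ i, x ∈ U i)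
    (hg : IsCechCocycle U g) : ∃ k, IsCechTrivialization U g k := by
  let : TopologicalSpace G := ⊥
  have : DiscreteTopology G := ⟨rfl⟩
  let Z := cechFiberBundleCore hU cover hg
  have isCovering : IsCoveringMap (Bundle.TotalSpace.proj : Bundle.TotalSpace G Z.Fiber → X) :=
    FiberBundle.isCoveringMap
  obtain ⟨x₀⟩ : Nonempty X := inferInstance
  obtain ⟨s, ⟨-, hs⟩, -⟩ :=
    isCovering.existsUnique_continuousMap_lifts (ContinuousMap.id X) x₀ ⟨x₀, (1 : G)⟩ rfl
  have proj_s (x : X) : (s x).proj = x := congrFun hs x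
  refine ⟨fun i x => ((Z.localTriv i) (s x)).2, fun i x hx => ?_, fun i j x hi hj => ?_⟩
  · have mem_source : s x ∈ (Z.localTriv i).source := by
      rwa [Z.mem_localTriv_source, proj_s]
    have continuousAt_coord : ContinuousAt (fun y => ((Z.localTriv i) (s y)).2) x :=
      continuous_snd.continuousAt.comp
        (((Z.localTriv i).continuousAt mem_source).comp s.continuous.continuousAt)
    exact continuousAt_coord.eventually ((isOpen_discrete {_}).mem_nhds rfl)
  · rw [← proj_s x] at hi hj
    have hx := Z.mem_baseSet_at (s x).proj
    exact (Z.coordChange_comp _ i j _ ⟨⟨hx, hi⟩, hj⟩ (s x).2).symm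

namespace IsCechTrivialization

variable {Y : Type*} [TopologicalSpace Y] {k k' : ι → X → G}

theorem comp (h : IsCechTrivialization U g k) {f : Y → X} (hf : Continuous f) :
    IsCechTrivialization (fun i => f ⁻¹' U i) g fun i => k i ∘ f where
  eventually_eq i y hy := hf.continuousAt.eventually (h.eventually_eq i (f y) hy)
  eq_mul i j y := h.eq_mul i j (f y)

theorem exists_eq_const_mul [PreconnectedSpace X] [Nonempty X] (hU : ∀ i, IsOpen (U i))
    (cover : ∀ x, ∃ i, x ∈ U i) (h : IsCechTrivialization U g k)
    (h' : IsCechTrivialization U g k') : ∃ c : G, ∀ i, ∀ x ∈ U i, k' i x = c * k i x := by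
  choose index mem_index using cover
  let ratio (x : X) : G := k' (index x) x * (k (index x) x)⁻¹
  have ratio_eq (i : ι) (x : X) (hx : x ∈ U i) : ratio x = k' i x * (k i x)⁻¹ := by
    simp only [ratio, h.eq_mul i _ x hx (mem_index x), h'.eq_mul i _ x hx (mem_index x)]
    group
  have ratio_isLocallyConstant : IsLocallyConstant ratio := by
    rw [IsLocallyConstant.iff_eventually_eq]
    intro x
    filter_upwards [h.eventually_eq _ x (mem_index x), h'.eventually_eq _ x (mem_index x),
      (hU _).mem_nhds (mem_index x)] with y hk hk' hy
    rw [ratio_eq _ y hy, hk, hk']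
  obtain ⟨x₀⟩ := ‹Nonempty X›
  refine ⟨ratio x₀, fun i x hx => ?_⟩
  rw [ratio_isLocallyConstant.apply_eq_of_preconnectedSpace x₀ x, ratio_eq i x hx,
    inv_mul_cancel_right]

theorem exists_monodromy [PreconnectedSpace X] [AddMonoid X] [ContinuousAdd X] {Λ : Type*}
    [AddMonoid Λ] (L : Λ →+ X) (hU : ∀ i, IsOpen (U i)) (cover : ∀ x, ∃ i, x ∈ U i)
    (hL : ∀ a i x, L a + x ∈ U i ↔ x ∈ U i) (h : IsCechTrivialization U g k) :
    ∃ ρ : Multiplicative Λ →* G, ∀ a i, ∀ x ∈ U i, k i (L a + x) = ρ (.ofAdd a) * k i x := by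
  have translate (a : Λ) : IsCechTrivialization U g fun i => k i ∘ (L a + ·) := by
    simpa only [preimage, hL, ofPred_mem_eq] using h.comp (continuous_const_add (L a))
  choose ρ hρ using fun a => h.exists_eq_const_mul hU cover (translate a)
  simp only [Function.comp_apply] at hρ
  refine ⟨.mk' (fun a => ρ a.toAdd) fun a b => ?_, hρ⟩
  obtain ⟨i, hi⟩ := cover 0
  apply mul_right_cancel (b := k i 0)
  rw [toAdd_mul, ← hρ _ i 0 hi, map_add, add_assoc, hρ _ i _ ((hL _ i 0).mpr hi), hρ _ i 0 hi,
    mul_assoc]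

theorem exists_descent {U : ι → Set Y} {q : X → Y} (hU : ∀ i, IsOpen (U i)) (hq : IsOpenMap q)
    (h : IsCechTrivialization (fun i => q ⁻¹' U i) g k)
    (hk : ∀ i x x', q x ∈ U i → q x = q x' → k i x = k i x') :
    ∃ k', IsCechTrivialization (fun i => U i ∩ range q) g k' := by
  classical
  let k' (i : ι) (y : Y) : G := if hy : y ∈ range q then k i hy.choose else 1
  have k'_apply (i : ι) (x : X) (hx : q x ∈ U i) : k' i (q x) = k i x := by
    have hy := mem_range_self (f := q) x
    simp only [k', dif_pos hy]
    exact (hk i x _ hx hy.choose_spec.symm).symm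
  refine ⟨k', ?_, ?_⟩
  · rintro i _ ⟨hy, x, rfl⟩
    filter_upwards [hq.image_mem_nhds (h.eventually_eq i x hy), (hU i).mem_nhds hy]
    rintro _ ⟨x', hx', rfl⟩ hy'
    rw [k'_apply i x' hy', k'_apply i x hy, hx']
  · rintro i j _ ⟨hi, x, rfl⟩ ⟨hj, -⟩
    rw [k'_apply i x hi, k'_apply j x hj, h.eq_mul i j x hi hj]

end IsCechTrivialization

end CechCocycle

section Torus

/-- The universal covering of the torus by the plane. -/
def torusCover : ℝ × ℝ → UnitAddCircle × UnitAddCircle :=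
  Prod.map (↑) (↑)

/-- The automorphism of `T × T` given by the integer matrix `!![a, -v; b, u]` of determinant one;
its first column is an arbitrary primitive vector. -/
def unimodularHomeomorph (T : Type*) [AddCommGroup T] [TopologicalSpace T]
    [IsTopologicalAddGroup T] {a b u v : ℤ} (h : u * a + v * b = 1) : T × T ≃ₜ T × T where
  toFun p := (a • p.1 - v • p.2, b • p.1 + u • p.2)
  invFun p := (u • p.1 + v • p.2, a • p.2 - b • p.1)
  left_inv p := by
    ext
    · dsimp only
      linear_combination (norm := module) h • p.1
    · dsimp only
      linear_combination (norm := module) h • p.2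
  right_inv p := by
    ext
    · dsimp only
      linear_combination (norm := module) h • p.1
    · dsimp only
      linear_combination (norm := module) h • p.2

theorem isOpenMap_torusCover : IsOpenMap torusCover :=
  QuotientAddGroup.isOpenMap_coe.prodMap QuotientAddGroup.isOpenMap_coe

theorem continuous_torusCover : Continuous torusCover :=
  (AddCircle.continuous_mk' 1).prodMap (AddCircle.continuous_mk' 1)

theorem torusCover_intCast_add (a : ℤ × ℤ) (p : ℝ × ℝ) :
    torusCover ((Int.castAddHom ℝ).prodMap (Int.castAddHom ℝ) a + p) = torusCover p := by
  ext <;> simp [torusCover]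

theorem torusCover_unimodularHomeomorph {a b u v : ℤ} (h : u * a + v * b = 1) (p : ℝ × ℝ) :
    torusCover (unimodularHomeomorph ℝ h p) =
      unimodularHomeomorph UnitAddCircle h (torusCover p) := by
  simp [torusCover, unimodularHomeomorph]

theorem range_torusCover_strip :
    range (torusCover ∘ Prod.map id ((↑) : Ioo (0 : ℝ) 1 → ℝ)) = {z | z.2 ≠ 0} := by
  have range_coe : range (fun t : Ioo (0 : ℝ) 1 => ((t : ℝ) : UnitAddCircle)) = {0}ᶜ := by
    rw [← image_eq_range]
    simpa using (AddCircle.openPartialHomeomorphCoe (1 : ℝ) 0).image_source_eq_target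
  have map_map : torusCover ∘ Prod.map id ((↑) : Ioo (0 : ℝ) 1 → ℝ) =
      Prod.map (↑) fun t : Ioo (0 : ℝ) 1 => ((t : ℝ) : UnitAddCircle) := rfl
  rw [map_map, range_prodMap, range_coe, QuotientAddGroup.mk_surjective.range_eq]
  ext z
  simp

theorem exists_intCast_add_of_torusCover_eq {s s' t t' : ℝ} (ht : t ∈ Ioo (0 : ℝ) 1)
    (ht' : t' ∈ Ioo (0 : ℝ) 1) (h : torusCover (s, t) = torusCover (s', t')) :
    ∃ n : ℤ, (s', t') = (n + s, t) := by
  obtain ⟨hs, ht_eq⟩ := Prod.ext_iff.mp h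
  obtain ⟨n, hn⟩ := AddCircle.coe_eq_zero_iff (1 : ℝ) |>.mp
    (show ((s' - s : ℝ) : UnitAddCircle) = 0 from sub_eq_zero.mpr hs.symm)
  refine ⟨n, Prod.ext ?_ ?_⟩
  · simp only [zsmul_eq_mul, mul_one] at hn
    linarith
  · refine (AddCircle.openPartialHomeomorphCoe (1 : ℝ) 0).injOn ?_ ?_ ht_eq.symm <;> simpa

variable {ι X G : Type*} [Group G] {g : ι → ι → G}

theorem IsCechTrivialization.exists_of_periodic {U : ι → Set (UnitAddCircle × UnitAddCircle)}
    {k : ι → ℝ × ℝ → G} (hU : ∀ i, IsOpen (U i))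
    (h : IsCechTrivialization (fun i => torusCover ⁻¹' U i) g k)
    (hk : ∀ i (n : ℤ) (s t : ℝ), torusCover (s, t) ∈ U i → k i (n + s, t) = k i (s, t)) :
    ∃ k', IsCechTrivialization (fun i => U i ∩ {z | z.2 ≠ 0}) g k' := by
  let strip : ℝ × Ioo (0 : ℝ) 1 → ℝ × ℝ := Prod.map id (↑)
  have isOpenMap_strip : IsOpenMap strip := .prodMap .id isOpen_Ioo.isOpenMap_subtype_val
  rw [← range_torusCover_strip]
  refine (h.comp (f := strip) (by fun_prop)).exists_descent hU
    (isOpenMap_torusCover.comp isOpenMap_strip) ?_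
  rintro i ⟨s, t, ht⟩ ⟨s', t', ht'⟩ hst heq
  obtain ⟨n, hn⟩ := exists_intCast_add_of_torusCover_eq ht ht' heq
  exact (congrArg (k i) hn).trans (hk i n s t hst) |>.symm

theorem IsCechCocycle.exists_homeomorph_isCechTrivialization [TopologicalSpace X]
    (e : X ≃ₜ UnitAddCircle × UnitAddCircle) {U : ι → Set X} (hU : ∀ i, IsOpen (U i))
    (cover : ∀ x, ∃ i, x ∈ U i) (hg : IsCechCocycle U g)
    (hG : ∀ ρ : Multiplicative (ℤ × ℤ) →* G, ∃ a b, IsCoprime a b ∧ ρ (.ofAdd (a, b)) = 1) :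
    ∃ (e' : X ≃ₜ UnitAddCircle × UnitAddCircle) (k : ι → X → G),
      IsCechTrivialization (fun i => U i ∩ {x | (e' x).2 ≠ 0}) g k := by
  let F := e.symm ∘ torusCover
  have continuous_F : Continuous F := e.symm.continuous.comp continuous_torusCover
  have isOpen_preimage (i : ι) : IsOpen (F ⁻¹' U i) := (hU i).preimage continuous_F
  obtain ⟨k, hk⟩ :=
    (hg.preimage F).exists_isCechTrivialization isOpen_preimage fun p => cover (F p)
  obtain ⟨ρ, hρ⟩ := hk.exists_monodromy ((Int.castAddHom ℝ).prodMap (Int.castAddHom ℝ))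
    isOpen_preimage (fun p => cover (F p)) fun a i p => by
      simp only [F, mem_preimage, Function.comp_apply, torusCover_intCast_add]
  obtain ⟨a, b, ⟨u, v, huv⟩, hρab⟩ := hG ρ
  let A := unimodularHomeomorph ℝ huv
  let e' := e.trans (unimodularHomeomorph UnitAddCircle huv).symm
  have F_A (p : ℝ × ℝ) : F (A p) = e'.symm (torusCover p) :=
    congrArg e.symm (torusCover_unimodularHomeomorph huv p)
  have preimage_A (i : ι) : A ⁻¹' (F ⁻¹' U i) = torusCover ⁻¹' (e'.symm ⁻¹' U i) := by
    ext p
    simp only [mem_preimage, F_A]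
  have A_add (n : ℤ) (s t : ℝ) : A (n + s, t) =
      (Int.castAddHom ℝ).prodMap (Int.castAddHom ℝ) (n • (a, b)) + A (s, t) := by
    ext <;> simp [A, unimodularHomeomorph] <;> ring
  have hkA := hk.comp A.continuous
  simp only [preimage_A] at hkA
  obtain ⟨k', hk'⟩ := hkA.exists_of_periodic (fun i => (hU i).preimage e'.symm.continuous)
    fun i n s t hst => by
      have mem_U : F (A (s, t)) ∈ U i := F_A (s, t) ▸ hst
      rw [Function.comp_apply, A_add, hρ _ i _ mem_U, ofAdd_zsmul, map_zpow, hρab, one_zpow,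
        one_mul, Function.comp_apply]
  refine ⟨e', fun i => k' i ∘ e', ?_⟩
  simpa only [preimage_inter, ← preimage_comp, e'.symm_comp_self, preimage_id, preimage_ofPred_eq]
    using hk'.comp e'.continuous

end Torus

section TwoRegularGraph

open SimpleGraph

variable {V : Type*} {G : SimpleGraph V}

theorem exists_isHamiltonianCycle [Finite V] [DecidableEq V] [Nontrivial V] (hG : G.Connected)
    (hG' : G.IsCycles) : ∃ v, ∃ p : G.Walk v v, p.IsHamiltonianCycle := by
  obtain ⟨v⟩ := hG.nonempty
  obtain ⟨p, hp, verts_p⟩ := hG'.exists_cycle_toSubgraph_verts_eq_connectedComponentSupp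
    (c := G.connectedComponentMk v) rfl (hG.preconnected.exists_adj_of_nontrivial v)
  refine ⟨v, p, hp, hp.isPath_tail.isHamiltonian_of_mem fun u => ?_⟩
  have mem_support : u ∈ p.support := by
    rw [← Walk.mem_verts_toSubgraph, verts_p]
    exact ConnectedComponent.sound (hG.preconnected u v)
  rw [← Walk.cons_support_tail hp.not_nil] at mem_support
  rcases List.mem_cons.mp mem_support with rfl | h
  · exact Walk.end_mem_support _
  · exact h

theorem ncard_neighborSet_cycleGraph {n : ℕ} (hn : 3 ≤ n) (i : Fin n) :
    ((cycleGraph n).neighborSet i).ncard = 2 := by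
  obtain ⟨n, rfl⟩ := Nat.exists_eq_add_of_le' hn
  rw [ncard_eq_toFinset_card', toFinset_card, card_neighborSet_eq_degree,
    cycleGraph_degree_three_le]

theorem nonempty_cycleGraph_iso [Fintype V] (hG : G.Connected)
    (hG' : ∀ v, (G.neighborSet v).ncard = 2) :
    Nonempty (cycleGraph (Fintype.card V) ≃g G) := by
  classical
  obtain ⟨v₀⟩ := hG.nonempty
  obtain ⟨w, hw⟩ : (G.neighborSet v₀).Nonempty := nonempty_of_ncard_ne_zero (by simp [hG'])
  have : Nontrivial V := ⟨v₀, w, hw.ne⟩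
  obtain ⟨v, p, hp⟩ := exists_isHamiltonianCycle hG fun v _ => hG' v
  have three_le_card := hp.length_eq ▸ hp.three_le_length
  obtain ⟨φ, φ_injective⟩ := (cycleGraph_isContained_iff three_le_card).mpr
    ⟨v, p, hp.isCycle, hp.length_eq⟩
  have φ_bijective : Function.Bijective φ :=
    (Fintype.bijective_iff_injective_and_card φ).mpr ⟨φ_injective, Fintype.card_fin _⟩
  refine ⟨.ofBijective φ φ_bijective, fun {i j} => ⟨fun h => ?_, φ.map_adj⟩⟩
  have image_neighborSet : φ '' (cycleGraph _).neighborSet i = G.neighborSet (φ i) :=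
    eq_of_subset_of_ncard_le (image_subset_iff.mpr fun _ => φ.map_adj) <| by
      rw [hG', ncard_image_of_injective _ φ_injective, ncard_neighborSet_cycleGraph three_le_card]
  exact φ_injective.mem_set_image.mp (image_neighborSet.symm ▸ h)

theorem colorable_two_of_even_card [Fintype V] (hG : G.Connected)
    (hG' : ∀ v, (G.neighborSet v).ncard = 2) (heven : Even (Fintype.card V)) : G.Colorable 2 := by
  obtain ⟨φ⟩ := nonempty_cycleGraph_iso hG hG'
  have coloring : G.Coloring Bool :=
    (cycleGraph.bicoloring_of_even _ heven).comp φ.symm.toHom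
  exact coloring.colorable

end TwoRegularGraph

section Coloring

variable {V : Type*} {K : AbstractSimplicialComplex V}

/-- A coloring `c` of the vertices that is proper on the closed star of the vertex `v`; the
colors of the vertices outside of this star are irrelevant. -/
def IsStarColoring {α : Type*} (K : AbstractSimplicialComplex V) (v : V) (c : V → α) : Prop :=
  ∀ s ∈ K.faces, v ∈ s → InjOn c s

/-- The permutation `g v w` of the colors turns the coloring `c w` into the coloring `c v` on the
faces that contain both `v` and `w`. -/
def IsTransition {α : Type*} (K : AbstractSimplicialComplex V) (c : V → V → α)
    (g : V → V → Equiv.Perm α) : Prop :=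
  ∀ v w, ∀ s ∈ K.faces, v ∈ s → w ∈ s → ∀ u ∈ s, g v w (c w u) = c v u

theorem exists_perm_fin_three : ∀ a b a' b' : Fin 3, a ≠ b → a' ≠ b' →
    ∃ g : Equiv.Perm (Fin 3), g a = a' ∧ g b = b' ∧
      ∀ c c', c ≠ a → c ≠ b → c' ≠ a' → c' ≠ b' → g c = c' := by
  decide

theorem exists_isTransition {c : V → V → Fin 3} (hc : ∀ v, IsStarColoring K v (c v)) :
    ∃ g, IsTransition K c g := by
  have exists_perm (v w : V) : ∃ σ : Equiv.Perm (Fin 3),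
      ∀ s ∈ K.faces, v ∈ s → w ∈ s → ∀ u ∈ s, σ (c w u) = c v u := by
    obtain rfl | hvw := eq_or_ne v w
    · exact ⟨1, fun _ _ _ _ _ _ => rfl⟩
    by_cases hface : ∃ s ∈ K.faces, v ∈ s ∧ w ∈ s
    · obtain ⟨s₀, hs₀, hv₀, hw₀⟩ := hface
      obtain ⟨σ, σ_v, σ_w, σ_other⟩ := exists_perm_fin_three (c w v) (c w w) (c v v) (c v w)
        ((hc w s₀ hs₀ hw₀).ne hv₀ hw₀ hvw) ((hc v s₀ hs₀ hv₀).ne hv₀ hw₀ hvw)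
      refine ⟨σ, fun s hs hv hw u hu => ?_⟩
      obtain rfl | huv := eq_or_ne u v
      · exact σ_v
      obtain rfl | huw := eq_or_ne u w
      · exact σ_w
      have injOn_v := hc v s hs hv
      have injOn_w := hc w s hs hw
      exact σ_other _ _ (injOn_w.ne hu hv huv) (injOn_w.ne hu hw huw) (injOn_v.ne hu hv huv)
        (injOn_v.ne hu hw huw)
    · exact ⟨1, fun s hs hv hw => (hface ⟨s, hs, hv, hw⟩).elim⟩
  choose g hg using exists_perm
  exact ⟨g, hg⟩

theorem IsTransition.mul_eq {c : V → V → Fin 3} {g : V → V → Equiv.Perm (Fin 3)}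
    (hc : ∀ v, IsStarColoring K v (c v)) (hg : IsTransition K c g) {τ : Finset V}
    (hτ : τ ∈ K.faces) (card_τ : #τ = 3) {v w y : V} (hv : v ∈ τ) (hw : w ∈ τ) (hy : y ∈ τ) :
    g v w * g w y = g v y := by
  have surjOn : SurjOn (c y) τ (Finset.univ : Finset (Fin 3)) :=
    Finset.surjOn_of_injOn_of_card_le _ (fun _ _ => Finset.mem_coe.mpr (Finset.mem_univ _))
      (hc y τ hτ hy) (by simp [card_τ])
  ext i
  obtain ⟨u, hu, rfl⟩ := surjOn (Finset.mem_coe.mpr (Finset.mem_univ i))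
  rw [Equiv.Perm.mul_apply, hg w y τ hτ hw hy u hu, hg v w τ hτ hv hw u hu,
    hg v y τ hτ hv hy u hu]

section LinkColoring

variable [DecidableEq V] {v : V}

theorem graph_adj_of_mem_faces {s : Finset V} (hs : s ∈ K.faces) {x y : V} (hx : x ∈ s)
    (hy : y ∈ s) (hxy : x ≠ y) : K.graph.Adj x y :=
  ⟨hxy, (K.isRelLowerSet_faces hs).2 (by simp [Finset.insert_subset_iff, hx, hy]) (by simp)⟩

theorem exists_isStarColoring_of_colorable_linkGraph {n : ℕ} (h : (K.linkGraph v).Colorable n) :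
    ∃ c : V → Fin (n + 1), IsStarColoring K v c := by
  classical
  obtain ⟨f⟩ := h
  let c (u : V) : Fin (n + 1) :=
    if hu : u ∈ K.graph.neighborSet v then (f ⟨u, hu⟩).succ else 0
  have c_v : c v = 0 := dif_neg (K.graph.irrefl (v := v))
  have c_neighbor {u : V} (hu : K.graph.Adj v u) : c u = (f ⟨u, hu⟩).succ := dif_pos hu
  refine ⟨c, fun s hs hv => ?_⟩
  have c_ne_c_v {u : V} (hu : u ∈ s) (huv : v ≠ u) : c u ≠ c v := by
    rw [c_neighbor (graph_adj_of_mem_faces hs hv hu huv), c_v]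
    exact Fin.succ_ne_zero _
  intro x hx y hy
  contrapose!
  intro hxy
  obtain rfl | hvx := eq_or_ne v x
  · exact (c_ne_c_v hy hxy).symm
  obtain rfl | hvy := eq_or_ne v y
  · exact c_ne_c_v hx hvx
  have adj : (K.linkGraph v).Adj ⟨x, graph_adj_of_mem_faces hs hv hx hvx⟩
      ⟨y, graph_adj_of_mem_faces hs hv hy hvy⟩ :=
    ⟨fun h => hxy (congrArg Subtype.val h), (K.isRelLowerSet_faces hs).2
      (by simp [Finset.insert_subset_iff, hv, Finset.mem_coe.mp hx, Finset.mem_coe.mp hy])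
      (by simp)⟩
  rw [c_neighbor (graph_adj_of_mem_faces hs hv hx hvx),
    c_neighbor (graph_adj_of_mem_faces hs hv hy hvy)]
  exact (Fin.succ_injective n).ne (f.valid adj)

theorem exists_isStarColoring_of_even_vertexDegree [Finite V]
    (hK : K.IsTriangulatedClosedSurface) (hv : Even (K.vertexDegree v)) :
    ∃ c : V → Fin 3, IsStarColoring K v c := by
  have := Fintype.ofFinite (K.graph.neighborSet v)
  rw [vertexDegree, ← Nat.card_coe_set_eq, Nat.card_eq_fintype_card] at hv
  exact exists_isStarColoring_of_colorable_linkGraph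
    (colorable_two_of_even_card (hK.link_connected v) (hK.link_regular v) hv)

theorem exists_triangle_of_adj (hK : K.IsTriangulatedClosedSurface) {w : V}
    (h : K.graph.Adj v w) : ∃ τ ∈ K.faces, #τ = 3 ∧ {v, w} ⊆ τ := by
  obtain ⟨u, hwu, hτ⟩ : ((K.linkGraph v).neighborSet ⟨w, h⟩).Nonempty :=
    nonempty_of_ncard_ne_zero (by simp [hK.link_regular])
  refine ⟨_, hτ, Finset.card_eq_three.mpr ⟨v, w, u, h.ne, u.2.1, ?_, rfl⟩,
    by simp [Finset.insert_subset_iff]⟩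
  exact fun heq => hwu (Subtype.ext heq)

theorem exists_triangle_superset (hK : K.IsTriangulatedClosedSurface) {s : Finset V}
    (hs : s ∈ K.faces) : ∃ τ ∈ K.faces, #τ = 3 ∧ s ⊆ τ := by
  have card_pos : 0 < #s := (K.isRelLowerSet_faces hs).1.card_pos
  have card_le_three := hK.card_le_three s hs
  obtain h | h | h : #s = 1 ∨ #s = 2 ∨ #s = 3 := by lia
  · obtain ⟨v, rfl⟩ := Finset.card_eq_one.mp h
    obtain ⟨w, hvw⟩ := (hK.link_connected v).nonempty
    obtain ⟨τ, hτ, card_τ, hsub⟩ := exists_triangle_of_adj hK hvw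
    exact ⟨τ, hτ, card_τ, (Finset.subset_insert w {v}).trans (Finset.pair_comm v w ▸ hsub)⟩
  · obtain ⟨v, w, hvw, rfl⟩ := Finset.card_eq_two.mp h
    exact exists_triangle_of_adj hK ⟨hvw, hs⟩
  · exact ⟨s, hs, h, Finset.Subset.rfl⟩

end LinkColoring

variable [Fintype V]

/-- The points of the realization whose carrier contains `v`. -/
def openStar (K : AbstractSimplicialComplex V) (v : V) : Set K.realization :=
  {x | x.1 v ≠ 0}

theorem isOpen_openStar (v : V) : IsOpen (openStar K v) :=
  isOpen_ne_fun ((continuous_apply v).comp continuous_subtype_val) continuous_const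

theorem exists_mem_openStar (x : K.realization) : ∃ v, x ∈ openStar K v := by
  obtain ⟨s, -, hx, -⟩ := x.2
  by_contra! h
  simp only [openStar, mem_ofPred_eq, not_not] at h
  simpa [h] using hx.2

theorem mem_of_mem_openStar {x : K.realization} {v : V} (hv : x ∈ openStar K v) {s : Finset V}
    (hx : x.1 ∈ closedCell s) : v ∈ s :=
  not_not.mp fun h => hv (hx.2 v h)

theorem isCechCocycle_openStar [DecidableEq V] (hK : K.IsTriangulatedClosedSurface)
    {c : V → V → Fin 3} {g : V → V → Equiv.Perm (Fin 3)} (hc : ∀ v, IsStarColoring K v (c v))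
    (hg : IsTransition K c g) : IsCechCocycle (openStar K) g := by
  intro v w y x hv hw hy
  obtain ⟨s, hs, hxs⟩ := x.2
  obtain ⟨τ, hτ, card_τ, hsτ⟩ := exists_triangle_superset hK hs
  exact hg.mul_eq hc hτ card_τ (hsτ (mem_of_mem_openStar hv hxs))
    (hsτ (mem_of_mem_openStar hw hxs)) (hsτ (mem_of_mem_openStar hy hxs))

theorem exists_coloring_of_isCechTrivialization {α : Type*} {c : V → V → α}
    {g : V → V → Equiv.Perm α} {k : V → K.realization → Equiv.Perm α} {C : Set (V → ℝ)}
    (hc : ∀ v, IsStarColoring K v (c v)) (hg : IsTransition K c g)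
    (hk : IsCechTrivialization (fun v => openStar K v ∩ {x | x.1 ∉ C}) g k) :
    ∃ κ : K.realization → V → α, ∀ s ∈ K.faces, ∀ x : K.realization, x.1 ∈ closedCell s \ C →
      InjOn (κ x) s ∧ ∀ᶠ y : K.realization in 𝓝 x, y.1 ∈ closedCell s \ C → EqOn (κ y) (κ x) s := by
  choose carrier mem_carrier using exists_mem_openStar (K := K)
  let κ (x : K.realization) (u : V) : α := k (carrier x) x (c (carrier x) u)
  have κ_eqOn {s : Finset V} (hs : s ∈ K.faces) {v : V} {x : K.realization}
      (hx : x.1 ∈ closedCell s \ C) (hv : x ∈ openStar K v) : EqOn (κ x) (k v x ∘ c v) s := by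
    intro u hu
    simp only [κ, Function.comp_apply]
    rw [hk.eq_mul v (carrier x) x ⟨hv, hx.2⟩ ⟨mem_carrier x, hx.2⟩, Equiv.Perm.mul_apply,
      hg v _ s hs (mem_of_mem_openStar hv hx.1) (mem_of_mem_openStar (mem_carrier x) hx.1) u hu]
  refine ⟨κ, fun s hs x hx => ?_⟩
  obtain ⟨v, hv⟩ := exists_mem_openStar x
  constructor
  · rw [(κ_eqOn hs hx hv).injOn_iff]
    exact (k v x).injective.comp_injOn (hc v s hs (mem_of_mem_openStar hv hx.1))
  · filter_upwards [hk.eventually_eq v x ⟨hv, hx.2⟩, (isOpen_openStar v).mem_nhds hv]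
      with y k_eq hyv hy u hu
    rw [κ_eqOn hs hy hyv hu, κ_eqOn hs hx hv hu, k_eq]

theorem colorableAfterCutting_of_eventually_eqOn {κ : K.realization → V → Fin 3} {C : Set (V → ℝ)}
    (hκ : ∀ s ∈ K.faces, ∀ x : K.realization, x.1 ∈ closedCell s \ C →
      InjOn (κ x) s ∧ ∀ᶠ y : K.realization in 𝓝 x, y.1 ∈ closedCell s \ C → EqOn (κ y) (κ x) s) :
    K.ColorableAfterCutting C := by
  classical
  let φ (x : V → ℝ) (u : V) : Fin 3 := if hx : x ∈ K.realization then κ ⟨x, hx⟩ u else 0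
  have φ_coe (x : K.realization) : φ x = κ x := funext fun u => dif_pos x.2
  refine ⟨fun _ => φ, fun τ hτ _ x hx => ?_, fun τ hτ _ S hS isPreconnected_S x hx y hy u hu => ?_,
    fun _ _ _ _ _ _ _ _ _ _ _ => rfl⟩
  · lift x to K.realization using ⟨τ, hτ, hx.1⟩
    dsimp only
    rw [φ_coe]
    exact (hκ τ hτ x hx).1
  · have S_subset : S ⊆ K.realization := fun z hz => ⟨τ, hτ, (hS hz).1⟩
    have isPreconnected_preimage : IsPreconnected ((↑) ⁻¹' S : Set K.realization) := by
      rwa [← IsInducing.subtypeVal.isPreconnected_image, Subtype.image_preimage_coe,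
        inter_eq_right.mpr S_subset]
    lift x to K.realization using S_subset hx
    lift y to K.realization using S_subset hy
    dsimp only
    rw [φ_coe, φ_coe]
    refine isPreconnected_preimage.constant (f := fun z => κ z u) (fun z hz => ?_) hx hy
    refine tendsto_nhds_of_eventually_eq ?_
    filter_upwards [self_mem_nhdsWithin, mem_nhdsWithin_of_mem_nhds (hκ τ hτ z (hS hz)).2]
      with w hw κ_eqOn
    exact κ_eqOn (hS hw) hu

end Coloring

theorem exists_isCoprime_map_eq_one (ρ : Multiplicative (ℤ × ℤ) →* Equiv.Perm (Fin 3)) :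
    ∃ a b, IsCoprime a b ∧ ρ (.ofAdd (a, b)) = 1 := by
  have eq_one_of_commute : ∀ σ τ : Equiv.Perm (Fin 3), σ * τ = τ * σ →
      σ = 1 ∨ τ = 1 ∨ σ * τ = 1 ∨ σ * τ⁻¹ = 1 := by decide
  rcases eq_one_of_commute (ρ (.ofAdd (1, 0))) (ρ (.ofAdd (0, 1)))
    (by rw [← map_mul ρ, ← map_mul ρ, mul_comm]) with h | h | h | h
  · exact ⟨1, 0, isCoprime_one_left, h⟩
  · exact ⟨0, 1, isCoprime_one_right, h⟩
  · exact ⟨1, 1, isCoprime_one_left, by rwa [← map_mul] at h⟩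
  · exact ⟨1, -1, isCoprime_one_left, by rwa [← map_inv, ← map_mul] at h⟩

theorem mainTheorem8_general {V : Type*} [Fintype V] [DecidableEq V]
    (K : AbstractSimplicialComplex V) (hK : K.IsTorusTriangulation) (heven : K.IsEven) :
    ∃ γ : UnitAddCircle → K.realization, Continuous γ ∧ Function.Injective γ ∧
      K.ColorableAfterCutting (Set.range fun t => (γ t : V → ℝ)) := by
  obtain ⟨e⟩ := hK.homeo_torus
  choose c hc using fun v => exists_isStarColoring_of_even_vertexDegree hK.surface (heven v)
  obtain ⟨g, hg⟩ := exists_isTransition hc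
  have isCechCocycle_g := isCechCocycle_openStar hK.surface hc hg
  obtain ⟨e', k, hk⟩ := isCechCocycle_g.exists_homeomorph_isCechTrivialization e isOpen_openStar
    exists_mem_openStar exists_isCoprime_map_eq_one
  let γ (t : UnitAddCircle) : K.realization := e'.symm (t, 0)
  have compl_range_γ : {x | (e' x).2 ≠ 0} = {x | x.1 ∉ range fun t => (γ t : V → ℝ)} := by
    ext x
    simp [γ, e'.symm_apply_eq, Prod.ext_iff, ← Subtype.ext_iff, eq_comm (a := (0 : UnitAddCircle))]
  rw [compl_range_γ] at hk
  obtain ⟨κ, hκ⟩ := exists_coloring_of_isCechTrivialization hc hg hk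
  exact ⟨γ, by fun_prop, fun s t hst => congrArg Prod.fst (e'.symm.injective hst),
    colorableAfterCutting_of_eventually_eqOn hκ⟩

theorem mainTheorem8 {V : Type*} [Fintype V] [DecidableEq V] (K : AbstractSimplicialComplex V)
    (hK : K.IsTorusTriangulation) (heven : K.IsEven) :
    K.VertexColorable ∨
      ∃ γ : UnitAddCircle → K.realization, Continuous γ ∧ Function.Injective γ ∧
        K.ColorableAfterCutting (Set.range fun t => (γ t : V → ℝ)) :=
  .inr (mainTheorem8_general K hK heven)
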